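/- Let $G$ be a Polish group and $X$ a Polish $G$-space, i.e. a Polish space with a continuous action of $G$. Write $E_G^X$ for the orbit equivalence relation and $[x]$ for the orbit of $x$. For $x,y\in X$, the Hjorth-isomorphism game $\mathrm{Iso}(x,y)$ is played as follows. Put $x_0=x$, $y_0=y$, $U_0^y=X$, $V_0^y=G$. For $n\ge 0$, at turn $2n+1$ Player I plays an open neighborhood $U_n^x$ of $x_n$ and an open neighborhood $V_n^x$ of the identity of $G$, and Player II replies with an element $g_n^y\in G$; put $y_{n+1}=g_n^y y_n$. At turn $2n+2$ Player I plays an open neighborhood $U_{n+1}^y$ of $y_{n+1}$ and an open neighborhood $V_{n+1}^y$ of the identity of $G$, and Player II replies with an element $g_n^x\in G$; put $x_{n+1}=g_n^x x_n$. Player II wins if, for every $n\ge 0$: - $y_{n+1}\in U_n^x$ and $x_n\in U_n^y$; - $g_n^y=h_k\cdots h_0$ for some $k\ge 0$ and $h_0,\dots,h_k\in V_n^y$ with $h_i\cdots h_0y_n\in U_n^y$ for all $i\le k$; - $g_n^x=h_k\cdots h_0$ for some $k\ge 0$ and $h_0,\dots,h_k\in V_n^x$ with $h_i\cdots h_0x_n\in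 U_n^x$ for all $i\le k$. Write $x\sim_{\mathcal H}y$ if Player II has a winning strategy in $\mathrm{Iso}(x,y)$. The Hjorth graph $\mathcal H(X/G)$ is the symmetric, reflexive graph with vertex set the set of orbits $X/G$ in which there is an edge between $[x]$ and $[y]$ if and only if $x\sim_{\mathcal H}y$ (this does not depend on the choice of representatives). For a $G$-invariant set $C\subseteq X$, $\mathcal H(C/G)$ is the induced subgraph of $\mathcal H(X/G)$ on the orbits contained in $C$. A function between Polish spaces is Baire-measurable if preimages of open sets have the property of Baire. **Proposition.** Let $G,H$ be Polish groups, $X$ a Polish $G$-space, $Y$ a Polish $H$-space, and let $f:X\to Y$ be a Baire-measurable function such that $x\,E_G^X\,x'$ implies $f(x)\,E_H^Y\,f(x')$ for all $x,x'\in X$. Then there is a $G$-invariant dense $G_\delta$ set $X_0\subseteq X$ such that the function $X_0/G\to Y/H$, $[x]\mapsto[f(x)]$, is a graph homomorphism from $\mathcal H(X_0/G)$ to $\mathcal H(Y/H)$. -/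

import Mathlib

section HjorthGame

variable {G X : Type*}

/-- `prodUpTo h i = h i * ⋯ * h 1 * h 0`. -/
def prodUpTo [Mul G] (h : ℕ → G) : ℕ → G
  | 0 => h 0
  | i + 1 => h (i + 1) * prodUpTo h i

/-- The points visited from `z` when moving successively by `g 0`, `g 1`, `g 2`, …:
`z₀ = z` and `zₙ₊₁ = g n • zₙ`. -/
def visited [SMul G X] (g : ℕ → G) (z : X) : ℕ → X
  | 0 => z
  | n + 1 => g n • visited g z n

/-- `g = h_k ⋯ h_0` for some `k ≥ 0` and `h_0, …, h_k ∈ V` such that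
`h_i ⋯ h_0 • z ∈ U` for all `i ≤ k`. -/
def IsLocalProduct [Mul G] [SMul G X] (U : Set X) (V : Set G) (z : X) (g : G) : Prop :=
  ∃ (k : ℕ) (h : ℕ → G), g = prodUpTo h k ∧
    ∀ i ≤ k, h i ∈ V ∧ prodUpTo h i • z ∈ U

/-- `(U, V)` is a legal move of Player I at the point `z`: `U` is an open neighborhood of `z` and
`V` is an open neighborhood of the identity. -/
def LegalMove [One G] [TopologicalSpace G] [TopologicalSpace X]
    (z : X) (m : Set X × Set G) : Prop :=
  (IsOpen m.1 ∧ z ∈ m.1) ∧ (IsOpen m.2 ∧ (1 : G) ∈ m.2)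

/-- A strategy for Player II in the Hjorth-isomorphism game. The moves of Player I are
`mx n = (U_n^x, V_n^x)` and `my n = (U_n^y, V_n^y)` for `n ≥ 0`, where `my 0 = (X, G)` is fixed in
advance. In turn `2n + 1` Player II has seen `mx 0, …, mx n`, `my 0, …, my n` and
replies with `g_n^y`; in turn `2n + 2` Player II has seen `mx 0, …, mx n`, `my 0, …, my (n + 1)`
and replies with `g_n^x`. -/
structure HjorthStrategy (G X : Type*) where
  replyY (n : ℕ) (mx my : Fin (n + 1) → Set X × Set G) : G
  replyX (n : ℕ) (mx : Fin (n + 1) → Set X × Set G) (my : Fin (n + 2) → Set X × Set G) : G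

/-- The sequence `g_n^y` produced by a strategy against the moves `mx`, `my` of Player I. -/
def HjorthStrategy.gY (σ : HjorthStrategy G X) (mx my : ℕ → Set X × Set G) (n : ℕ) : G :=
  σ.replyY n (fun i => mx i) (fun i => my i)

/-- The sequence `g_n^x` produced by a strategy against the moves `mx`, `my` of Player I. -/
def HjorthStrategy.gX (σ : HjorthStrategy G X) (mx my : ℕ → Set X × Set G) (n : ℕ) : G :=
  σ.replyX n (fun i => mx i) (fun i => my i)

/-- Player I has followed the rules of the game started at `(x, y)`: `my 0 = (X, G)`, and `mx n`,
`my n` are legal moves at `x_n`, `y_n`. -/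
def HjorthLegal [One G] [SMul G X] [TopologicalSpace G] [TopologicalSpace X] (x y : X)
    (mx my : ℕ → Set X × Set G) (gx gy : ℕ → G) : Prop :=
  my 0 = (Set.univ, Set.univ) ∧
    ∀ n, LegalMove (visited gx x n) (mx n) ∧ LegalMove (visited gy y n) (my n)

/-- The winning condition of Player II in the game started at `(x, y)`. -/
def HjorthWin [Mul G] [SMul G X] (x y : X)
    (mx my : ℕ → Set X × Set G) (gx gy : ℕ → G) : Prop :=
  ∀ n, (visited gy y (n + 1) ∈ (mx n).1 ∧ visited gx x n ∈ (my n).1) ∧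
    IsLocalProduct (my n).1 (my n).2 (visited gy y n) (gy n) ∧
    IsLocalProduct (mx n).1 (mx n).2 (visited gx x n) (gx n)

/-- The strategy `σ` wins for Player II the game started at `(x, y)`: Player II wins every run in
which Player I follows the rules and Player II replies according to `σ`. -/
def HjorthStrategy.IsWinning [Group G] [MulAction G X] [TopologicalSpace G] [TopologicalSpace X]
    (σ : HjorthStrategy G X) (x y : X) : Prop :=
  ∀ mx my : ℕ → Set X × Set G,
    HjorthLegal x y mx my (σ.gX mx my) (σ.gY mx my) →
      HjorthWin x y mx my (σ.gX mx my) (σ.gY mx my)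

/-- `x` and `y` are Hjorth-isomorphic: Player II has a winning strategy for `Iso(x, y)`. -/
def HjorthIso (G : Type*) {X : Type*} [Group G] [MulAction G X] [TopologicalSpace G]
    [TopologicalSpace X] (x y : X) : Prop :=
  ∃ σ : HjorthStrategy G X, σ.IsWinning x y

/-! Hjorth isomorphism is reflexive, symmetric, and invariant under the orbit equivalence relation;
this is what is needed to define the Hjorth graph on the space of orbits. -/

variable [Group G] [MulAction G X]

theorem visited_one (z : X) (n : ℕ) : visited (fun _ => (1 : G)) z n = z := by
  induction n with
  | zero => rfl
  | succ n ih => simp [visited, ih]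

/-- The move `(a⁻¹U, a⁻¹Va)`, corresponding at `z` to the move `(U, V)` at `a • z`. -/
def pullMove (a : G) (m : Set X × Set G) : Set X × Set G :=
  ((fun z => a • z) ⁻¹' m.1, (fun g => a * g * a⁻¹) ⁻¹' m.2)

theorem pullMove_univ (a : G) :
    pullMove a ((Set.univ, Set.univ) : Set X × Set G) = (Set.univ, Set.univ) := by
  simp [pullMove]

theorem prodUpTo_conj (a : G) (h : ℕ → G) (i : ℕ) :
    prodUpTo (fun j => a * h j * a⁻¹) i = a * prodUpTo h i * a⁻¹ := by
  induction i with
  | zero => rfl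
  | succ i ih => simp only [prodUpTo, ih]; group

theorem visited_conj (a : G) (g : ℕ → G) (z : X) (n : ℕ) :
    visited (fun j => a * g j * a⁻¹) (a • z) n = a • visited g z n := by
  induction n with
  | zero => rfl
  | succ n ih => simp only [visited, ih, smul_smul]; group

theorem IsLocalProduct.of_pull {a : G} {m : Set X × Set G} {z : X} {g : G}
    (h : IsLocalProduct (pullMove a m).1 (pullMove a m).2 z g) :
    IsLocalProduct m.1 m.2 (a • z) (a * g * a⁻¹) := by
  obtain ⟨k, p, rfl, hp⟩ := h
  refine ⟨k, fun j => a * p j * a⁻¹, (prodUpTo_conj a p k).symm, fun i hi => ⟨(hp i hi).1, ?_⟩⟩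
  have := (hp i hi).2
  simp only [pullMove, Set.mem_preimage] at this
  rw [prodUpTo_conj, smul_smul, inv_mul_cancel_right, mul_smul]
  exact this

theorem isLocalProduct_univ (z : X) (g : G) :
    IsLocalProduct (Set.univ : Set X) (Set.univ : Set G) z g :=
  ⟨0, fun _ => g, rfl, fun _ _ => ⟨trivial, trivial⟩⟩

variable [TopologicalSpace G] [TopologicalSpace X]

theorem LegalMove.pull [IsTopologicalGroup G] [ContinuousSMul G X] {a : G} {z : X}
    {m : Set X × Set G} (h : LegalMove (a • z) m) : LegalMove z (pullMove a m) := by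
  refine ⟨⟨h.1.1.preimage (continuous_const_smul a), h.1.2⟩,
    ⟨h.2.1.preimage (by fun_prop), ?_⟩⟩
  simpa [pullMove] using h.2.2

theorem HjorthIso.refl (x : X) : HjorthIso G x x := by
  refine ⟨⟨fun _ _ _ => 1, fun _ _ _ => 1⟩, ?_⟩
  intro mx my
  change HjorthLegal x x mx my (fun _ => 1) (fun _ => 1) →
    HjorthWin x x mx my (fun _ => 1) (fun _ => 1)
  intro hL n
  have hx := (hL.2 n).1
  have hy := (hL.2 n).2
  simp only [visited_one] at hx hy ⊢
  refine ⟨⟨hx.1.2, hy.1.2⟩, ⟨0, fun _ => 1, rfl, ?_⟩, ⟨0, fun _ => 1, rfl, ?_⟩⟩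
  · intro i hi
    obtain rfl : i = 0 := by omega
    exact ⟨hy.2.2, by simpa [prodUpTo] using hy.1.2⟩
  · intro i hi
    obtain rfl : i = 0 := by omega
    exact ⟨hx.2.2, by simpa [prodUpTo] using hx.1.2⟩

theorem HjorthIso.smul_smul [IsTopologicalGroup G] [ContinuousSMul G X] {x y : X}
    (h : HjorthIso G x y) (a : G) : HjorthIso G (a • x) (a • y) := by
  obtain ⟨σ, hσ⟩ := h
  refine ⟨⟨fun n mx my => a * σ.replyY n (fun i => pullMove a (mx i)) (fun i => pullMove a (my i))
    * a⁻¹, fun n mx my => a * σ.replyX n (fun i => pullMove a (mx i)) (fun i => pullMove a (my i))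
    * a⁻¹⟩, ?_⟩
  intro mx my
  change HjorthLegal (a • x) (a • y) mx my
    (fun n => a * σ.gX (fun i => pullMove a (mx i)) (fun i => pullMove a (my i)) n * a⁻¹)
    (fun n => a * σ.gY (fun i => pullMove a (mx i)) (fun i => pullMove a (my i)) n * a⁻¹) →
    HjorthWin (a • x) (a • y) mx my
    (fun n => a * σ.gX (fun i => pullMove a (mx i)) (fun i => pullMove a (my i)) n * a⁻¹)
    (fun n => a * σ.gY (fun i => pullMove a (mx i)) (fun i => pullMove a (my i)) n * a⁻¹)
  have hw := hσ (fun i => pullMove a (mx i)) (fun i => pullMove a (my i))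
  generalize σ.gX _ _ = gx at hw ⊢
  generalize σ.gY _ _ = gy at hw ⊢
  rintro ⟨h0, hL⟩
  simp only [visited_conj] at hL
  have hW := hw ⟨by simp only [h0, pullMove_univ], fun n => ⟨(hL n).1.pull, (hL n).2.pull⟩⟩
  intro n
  simp only [visited_conj]
  exact ⟨(hW n).1, (hW n).2.1.of_pull, (hW n).2.2.of_pull⟩

theorem HjorthIso.smul_right {x y : X} (h : HjorthIso G x y) (a : G) :
    HjorthIso G x (a • y) := by
  obtain ⟨σ, hσ⟩ := h
  refine ⟨⟨fun n mx my => if n = 0 then σ.replyY n mx my * a⁻¹ else σ.replyY n mx my,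
    σ.replyX⟩, ?_⟩
  intro mx my
  change HjorthLegal x (a • y) mx my (σ.gX mx my)
    (fun n => if n = 0 then σ.gY mx my n * a⁻¹ else σ.gY mx my n) →
    HjorthWin x (a • y) mx my (σ.gX mx my)
    (fun n => if n = 0 then σ.gY mx my n * a⁻¹ else σ.gY mx my n)
  have hw := hσ mx my
  generalize σ.gX _ _ = gx at hw ⊢
  generalize σ.gY _ _ = gy at hw ⊢
  have key : ∀ n, visited (fun n => if n = 0 then gy n * a⁻¹ else gy n) (a • y) (n + 1)
      = visited gy y (n + 1) := by
    intro n
    induction n with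
    | zero => simp [visited, mul_smul]
    | succ n ih => rw [visited, ih]; simp [visited]
  rintro ⟨h0, hL⟩
  have hW := hw ⟨h0, fun n => ⟨(hL n).1, by
    cases n with
    | zero => rw [h0]; simp [LegalMove]
    | succ n => simpa only [key] using (hL (n + 1)).2⟩⟩
  intro n
  refine ⟨by simpa only [key] using (hW n).1, ?_, (hW n).2.2⟩
  cases n with
  | zero => rw [h0]; exact isLocalProduct_univ _ _
  | succ n => simpa [key] using (hW (n + 1)).2.1

theorem HjorthIso.smul_left [IsTopologicalGroup G] [ContinuousSMul G X] {x y : X}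
    (h : HjorthIso G x y) (a : G) : HjorthIso G (a • x) y := by
  simpa using (h.smul_smul a).smul_right a⁻¹

theorem HjorthIso.symm [IsTopologicalGroup G] [ContinuousSMul G X] {x y : X}
    (h : HjorthIso G x y) : HjorthIso G y x := by
  obtain ⟨σ, hσ⟩ := h
  suffices H : ∃ a : G, HjorthIso G (a • y) x by
    obtain ⟨a, ha⟩ := H
    simpa using ha.smul_left a⁻¹
  refine ⟨σ.replyY 0 (fun _ => (Set.univ, Set.univ)) (fun _ => (Set.univ, Set.univ)),
    ⟨fun n mx my => σ.replyX n my (Fin.cons (Set.univ, Set.univ) mx),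
     fun n mx my => σ.replyY (n + 1) my (Fin.cons (Set.univ, Set.univ) mx)⟩, ?_⟩
  intro mx my
  have hw := hσ my (fun i => Nat.casesOn i (Set.univ, Set.univ) mx)
  have e : ∀ n, (Fin.cons (Set.univ, Set.univ) (fun i : Fin n => mx i) :
      Fin (n + 1) → Set X × Set G)
      = fun i : Fin (n + 1) => Nat.casesOn (i : ℕ) (Set.univ, Set.univ) mx := by
    intro n
    funext i
    refine Fin.cases rfl (fun j => ?_) i
    rfl
  change HjorthLegal _ x mx my
    (fun n => σ.replyY (n + 1) (fun i => my i)
      (Fin.cons (Set.univ, Set.univ) (fun i : Fin (n + 1) => mx i)))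
    (fun n => σ.replyX n (fun i => my i)
      (Fin.cons (Set.univ, Set.univ) (fun i : Fin (n + 1) => mx i))) →
    HjorthWin _ x mx my
    (fun n => σ.replyY (n + 1) (fun i => my i)
      (Fin.cons (Set.univ, Set.univ) (fun i : Fin (n + 1) => mx i)))
    (fun n => σ.replyX n (fun i => my i)
      (Fin.cons (Set.univ, Set.univ) (fun i : Fin (n + 1) => mx i)))
  simp only [e]
  rintro ⟨h0, hL⟩
  set gx := σ.gX my (fun i => Nat.casesOn i (Set.univ, Set.univ) mx) with hgx
  set gy := σ.gY my (fun i => Nat.casesOn i (Set.univ, Set.univ) mx) with hgy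
  have hg0 : σ.replyY 0 (fun _ => (Set.univ, Set.univ)) (fun _ => (Set.univ, Set.univ)) = gy 0 := by
    rw [hgy]
    unfold HjorthStrategy.gY
    congr 1
    · funext i; fin_cases i; exact h0.symm
    · funext i; fin_cases i; rfl
  rw [hg0] at hL ⊢
  change ∀ n, LegalMove (visited (fun n => gy (n + 1)) (gy 0 • y) n) (mx n) ∧
    LegalMove (visited gx x n) (my n) at hL
  change HjorthWin (gy 0 • y) x mx my (fun n => gy (n + 1)) gx
  have key : ∀ n, visited (fun n => gy (n + 1)) (gy 0 • y) n = visited gy y (n + 1) := by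
    intro n
    induction n with
    | zero => rfl
    | succ n ih => rw [visited, ih]; rfl
  simp only [key] at hL
  have hW := hw ⟨rfl, fun n => ⟨(hL n).2, by
    cases n with
    | zero => simp [LegalMove]
    | succ n => exact (hL n).1⟩⟩
  intro n
  simp only [key]
  exact ⟨⟨(hW (n + 1)).1.2, (hW n).1.1⟩, (hW n).2.2, (hW (n + 1)).2.1⟩

end HjorthGame

/-- A symmetric, reflexive graph. -/
structure ReflexiveGraph (V : Type*) where
  Adj : V → V → Prop
  symm : ∀ v w, Adj v w → Adj w v
  refl : ∀ v, Adj v v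

/-- The subgraph induced on a set of vertices. -/
def ReflexiveGraph.induce {V : Type*} (A : ReflexiveGraph V) (S : Set V) : ReflexiveGraph S where
  Adj v w := A.Adj v w
  symm v w := A.symm v w
  refl v := A.refl v

/-- `φ` is a graph homomorphism from `A` to `B`. -/
def ReflexiveGraph.IsHom {V W : Type*} (A : ReflexiveGraph V) (B : ReflexiveGraph W)
    (φ : V → W) : Prop :=
  ∀ v w, A.Adj v w → B.Adj (φ v) (φ w)

/-- The Hjorth graph `H(X/G)` on the space of orbits `X/G`: there is an edge between `[x]` and `[y]`
if and only if `x` and `y` are Hjorth-isomorphic. -/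
def hjorthGraph (G X : Type*) [Group G] [MulAction G X] [TopologicalSpace G] [IsTopologicalGroup G]
    [TopologicalSpace X] [ContinuousSMul G X] :
    ReflexiveGraph (MulAction.orbitRel.Quotient G X) where
  Adj := Quotient.lift₂ (HjorthIso G) (by
    rintro x y x' y' ⟨a, rfl⟩ ⟨b, rfl⟩
    refine propext ⟨fun h => ?_, fun h => (h.smul_left a).smul_right b⟩
    simpa using (h.smul_left a⁻¹).smul_right b⁻¹)
  symm := by
    rintro ⟨x⟩ ⟨y⟩ h
    exact HjorthIso.symm h
  refl := by
    rintro ⟨x⟩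
    exact HjorthIso.refl x

/-- `C/G`, the set of orbits of points of `C`. -/
def orbitsOf (G : Type*) {X : Type*} [Group G] [MulAction G X] (C : Set X) :
    Set (MulAction.orbitRel.Quotient G X) :=
  {q | ∃ x ∈ C, Quotient.mk (MulAction.orbitRel G X) x = q}

/-- The Hjorth graph `H(C/G)`: the induced subgraph of `H(X/G)` on the orbits of points of `C`. -/
def hjorthGraphOn (G : Type*) {X : Type*} [Group G] [MulAction G X]
    [TopologicalSpace G] [IsTopologicalGroup G] [TopologicalSpace X] [ContinuousSMul G X] (C : Set X) : ReflexiveGraph (orbitsOf G C) :=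
  (hjorthGraph G X).induce (orbitsOf G C)

/-- `f` is an `(E_G^X, E_H^Y)`-homomorphism. -/
def IsOrbitHom (G H : Type*) {X Y : Type*} [Group G] [Group H] [MulAction G X] [MulAction H Y]
    (f : X → Y) : Prop :=
  ∀ x x', MulAction.orbitRel G X x x' → MulAction.orbitRel H Y (f x) (f x')

/-- The map `X/G → Y/H`, `[x] ↦ [f x]`, induced by an `(E_G^X, E_H^Y)`-homomorphism. -/
def IsOrbitHom.orbitMap {G H X Y : Type*} [Group G] [Group H] [MulAction G X] [MulAction H Y]
    {f : X → Y} (hf : IsOrbitHom G H f) :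
    MulAction.orbitRel.Quotient G X → MulAction.orbitRel.Quotient H Y :=
  Quotient.map' f hf

/-- `f` is Baire-measurable: preimages of open sets have the property of Baire. -/
def BaireMeasurableMap {X Y : Type*} [TopologicalSpace X] [TopologicalSpace Y] (f : X → Y) :
    Prop :=
  ∀ U : Set Y, IsOpen U → BaireMeasurableSet (f ⁻¹' U)

/-! Off a meagre set `f` is continuous, and it also turns small moves in `G` into small moves in
`H`. Precisely (`exists_locally_translating`), there is a dense Gδ set `C` such that for `x₀ ∈ C`
and any neighborhood `W` of `1` in `H` there are neighborhoods `U` of `x₀` and `V` of `1` with `f (g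
• x) ∈ W • f x` for all `x ∈ U ∩ C` and generic `g ∈ V`. This is a category argument. For a small
`W₀`, countably many sets `W₀ * d n` cover `H`, and the sets of pairs `(x, g)` with `f (g • x) ∈ (W₀
* d n) • f x` are analytic modulo meagre sets, so they have the property of Baire. Near a generic
`g₀` one of them holds generically, and comparing `g₀` with its neighbors gives the claim at `g₀ •
x`.

Consequently a chain of small steps in `X`, once each step is perturbed to a generic one, is carried
by `f` to a chain of small steps in `Y`. Player II wins `Iso(f x, f y)` by simulating `Iso(x, y)`:
pull Player I's move back to `X`, take the reply of the winning strategy there, perturb it to land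
in `C`, and push it forward (`HjorthIso.map_of_isGenericallyLocal`). Each perturbation leaves a
small error `v`; the simulation absorbs it because Hjorth isomorphism is invariant under translating
both points by the same group element.

The set `X₀` consists of the points `x` with `g • x ∈ C` for generic `g`. It is invariant, and each
of its orbits meets `C`. -/

open Filter Topology Set

/-! ### Baire category: analytic sets, Kuratowski–Ulam, category quantifiers. -/

section Category

/-- The points near which `A` is nonmeagre. -/
def nonmeagreHull {X : Type*} [TopologicalSpace X] (A : Set X) : Set X :=
  {x | ∀ U, IsOpen U → x ∈ U → ¬ IsMeagre (A ∩ U)}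

variable {X G : Type*} [TopologicalSpace X] [TopologicalSpace G]

theorem isClosed_nonmeagreHull (A : Set X) : IsClosed (nonmeagreHull A) := by
  rw [← isOpen_compl_iff, isOpen_iff_forall_mem_open]
  intro x hx
  have hx' : ¬ ∀ U, IsOpen U → x ∈ U → ¬ IsMeagre (A ∩ U) := hx
  push Not at hx'
  obtain ⟨U, hU, hxU, hm⟩ := hx'
  exact ⟨U, fun y hy hyA => hyA U hU hy hm, hU, hxU⟩

theorem nonmeagreHull_subset_closure (A : Set X) : nonmeagreHull A ⊆ closure A := by
  intro x hx
  rw [mem_closure_iff]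
  intro U hU hxU
  rw [inter_comm]
  exact nonempty_of_not_isMeagre (hx U hU hxU)

theorem isMeagre_diff_nonmeagreHull [SecondCountableTopology X] (A : Set X) :
    IsMeagre (A \ nonmeagreHull A) := by
  have hB := TopologicalSpace.isBasis_countableBasis X
  refine IsMeagre.mono (?_ : _ ⊆ ⋃ B ∈ {B ∈ TopologicalSpace.countableBasis X | IsMeagre (A ∩ B)},
    A ∩ B) (isMeagre_biUnion
      ((TopologicalSpace.countable_countableBasis X).mono (fun _ h => h.1)) (fun B h => h.2))
  rintro x ⟨hxA, hx⟩
  have hx' : ¬ ∀ U, IsOpen U → x ∈ U → ¬ IsMeagre (A ∩ U) := hx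
  push Not at hx'
  obtain ⟨U, hU, hxU, hm⟩ := hx'
  obtain ⟨B, hB, hxB, hBU⟩ := hB.exists_subset_of_mem_open hxU hU
  exact mem_iUnion₂.2 ⟨B, ⟨hB, hm.mono (inter_subset_inter_right A hBU)⟩, hxA, hxB⟩

/-- Modulo a meagre set `s` is open, and the hypothesis forces that open set to be empty. -/
theorem BaireMeasurableSet.isMeagre_of_forall_isOpen {s : Set X} (hs : BaireMeasurableSet s)
    (h : ∀ O, IsOpen O → O.Nonempty → ¬ IsMeagre (O \ s)) : IsMeagre s := by
  obtain ⟨O, hO, hsO⟩ := hs.residualEq_isOpen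
  rw [Filter.eventuallyEq_set] at hsO
  rcases O.eq_empty_or_nonempty with rfl | hne
  · filter_upwards [hsO] with x hx
    simpa using hx
  · refine absurd ?_ (h O hO hne)
    filter_upwards [hsO] with x hx
    simp only [mem_compl_iff, Set.mem_sdiff]
    tauto

/-- If the difference were comeagre in a nonempty open `O`, then `O` would meet the hull of the
union. But inside `O` the union would be covered by the meagre sets `A i \ nonmeagreHull (A i)` and
one further meagre set. -/
theorem isMeagre_nonmeagreHull_iUnion_diff [SecondCountableTopology X] [BaireSpace X]
    {ι : Type*} [Countable ι] (A : ι → Set X) :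
    IsMeagre (nonmeagreHull (⋃ i, A i) \ ⋃ i, nonmeagreHull (A i)) := by
  have hb : BaireMeasurableSet (nonmeagreHull (⋃ i, A i) \ ⋃ i, nonmeagreHull (A i)) := by
    refine BaireMeasurableSet.diff ?_ (BaireMeasurableSet.iUnion fun i => ?_)
    · exact (isClosed_nonmeagreHull _).isOpen_compl.baireMeasurableSet.of_compl
    · exact (isClosed_nonmeagreHull _).isOpen_compl.baireMeasurableSet.of_compl
  refine hb.isMeagre_of_forall_isOpen fun O hO hne hm => ?_
  have hOK : (O ∩ nonmeagreHull (⋃ i, A i)).Nonempty := by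
    by_contra hemp
    refine not_isMeagre_of_isOpen hO hne (hm.mono fun x hx => ?_)
    exact ⟨hx, fun h => hemp ⟨x, hx, h.1⟩⟩
  obtain ⟨x, hxO, hxK⟩ := hOK
  refine hxK O hO hxO (IsMeagre.mono ?_
    ((isMeagre_iUnion fun i => isMeagre_diff_nonmeagreHull (A i)).union hm))
  rintro y ⟨hyA, hyO⟩
  by_cases hy : y ∈ ⋃ i, nonmeagreHull (A i)
  · exact Or.inr ⟨hyO, fun h => h.2 hy⟩
  · obtain ⟨i, hi⟩ := mem_iUnion.1 hyA
    exact Or.inl (mem_iUnion.2 ⟨i, hi, fun h => hy (mem_iUnion.2 ⟨i, h⟩)⟩)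

/-- Analytic sets have the property of Baire. -/
theorem MeasureTheory.AnalyticSet.baireMeasurableSet [SecondCountableTopology X] [BaireSpace X]
    [T2Space X] {A : Set X} (hA : AnalyticSet A) : BaireMeasurableSet A := by
  rw [AnalyticSet] at hA
  rcases hA with rfl | ⟨f, hf, rfl⟩
  · exact isOpen_empty.baireMeasurableSet
  -- `PiNat.res` lists the latest entry first, so `k :: s` prolongs the initial segment `s` by `k`.
  set N : List ℕ → Set (ℕ → ℕ) := fun s => {y | PiNat.res y s.length = s} with hN
  have hNU : ∀ s, f '' N s = ⋃ k, f '' N (k :: s) := by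
    intro s
    rw [← image_iUnion]
    congr 1
    ext y
    simp [hN, PiNat.res_succ]
  -- Off `M`, a point in the hull of a node is in the hull of some child. Starting at the root it
  -- follows an infinite branch `α`, and continuity of `f` forces the point to be `f α`.
  set M : Set X := ⋃ s : List ℕ, nonmeagreHull (f '' N s) \ ⋃ k, nonmeagreHull (f '' N (k :: s))
    with hM
  have hMm : IsMeagre M := by
    refine isMeagre_iUnion fun s => ?_
    rw [hNU]
    exact isMeagre_nonmeagreHull_iUnion_diff _
  have hN0 : f '' N [] = range f := by simp [hN]
  have hsub : nonmeagreHull (range f) \ range f ⊆ M := by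
    rintro x ⟨hxK, hxf⟩
    by_contra hxM
    have step : ∀ s, ∃ k, x ∈ nonmeagreHull (f '' N s) → x ∈ nonmeagreHull (f '' N (k :: s)) := by
      intro s
      by_cases hx : x ∈ nonmeagreHull (f '' N s)
      · by_contra hk
        push Not at hk
        refine hxM (mem_iUnion.2 ⟨s, hx, fun h => ?_⟩)
        obtain ⟨k, hk'⟩ := mem_iUnion.1 h
        exact (hk k).2 hk'
      · exact ⟨0, fun h => absurd h hx⟩
    choose k hk using step
    let L : ℕ → List ℕ := fun n => Nat.rec [] (fun _ s => k s :: s) n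
    have hL : ∀ n, x ∈ nonmeagreHull (f '' N (L n)) := by
      intro n
      induction n with
      | zero => change x ∈ nonmeagreHull (f '' N []); rwa [hN0]
      | succ n ih => exact hk _ ih
    have hres : ∀ n, PiNat.res (fun n => k (L n)) n = L n := by
      intro n
      induction n with
      | zero => rfl
      | succ n ih => rw [PiNat.res_succ, ih]
    set α : ℕ → ℕ := fun n => k (L n) with hα
    have hxα : x ≠ f α := fun h => hxf ⟨α, h.symm⟩
    obtain ⟨u, v, hu, hv, hxu, hfv, huv⟩ := t2_separation hxα
    obtain ⟨_, ⟨y, n, rfl⟩, hαy, hyv⟩ :=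
      (PiNat.isTopologicalBasis_cylinders (fun _ => ℕ)).exists_subset_of_mem_open
      (show α ∈ f ⁻¹' v from hfv) (hv.preimage hf)
    have hsubv : f '' N (L n) ⊆ v := by
      rintro _ ⟨z, hz, rfl⟩
      refine hyv ?_
      have hlen : (L n).length = n := by rw [← hres n, PiNat.res_length]
      have hz' : PiNat.res z n = L n := by
        have : PiNat.res z (L n).length = L n := hz
        rwa [hlen] at this
      rw [← PiNat.mem_cylinder_iff_eq.1 hαy, PiNat.cylinder_eq_res]
      exact hz'.trans (hres n).symm
    have := closure_mono hsubv (nonmeagreHull_subset_closure _ (hL n))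
    exact (huv.closure_right hu).le_bot ⟨hxu, this⟩
  have hdiff := isMeagre_diff_nonmeagreHull (range f)
  refine (isClosed_nonmeagreHull (range f)).isOpen_compl.baireMeasurableSet.of_compl.congr ?_
  rw [Filter.eventuallyEq_set]
  filter_upwards [hdiff, hMm] with x h1 h2
  refine ⟨fun h => ?_, fun h => ?_⟩
  · by_contra hx
    exact h2 (hsub ⟨h, hx⟩)
  · by_contra hx
    exact h1 ⟨h, hx⟩

theorem isOpen_setOf_exists_mem {O : Set (X × G)} (hO : IsOpen O) {B : Set G} (hB : IsOpen B) :
    IsOpen {x | ∃ g ∈ B, (x, g) ∈ O} := by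
  have heq : {x | ∃ g ∈ B, (x, g) ∈ O} = Prod.fst '' (O ∩ univ ×ˢ B) := by
    ext x
    constructor
    · rintro ⟨g, hg, hxg⟩
      exact ⟨(x, g), ⟨hxg, trivial, hg⟩, rfl⟩
    · rintro ⟨⟨x, g⟩, ⟨hxg, -, hg⟩, rfl⟩
      exact ⟨g, hg, hxg⟩
  rw [heq]
  exact isOpenMap_fst _ (hO.inter (isOpen_univ.prod hB))

/-- Sections of a comeagre set are generically comeagre (Kuratowski–Ulam). -/
theorem Filter.Eventually.residual_section [SecondCountableTopology G] {p : X × G → Prop}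
    (h : ∀ᶠ z in residual (X × G), p z) :
    ∀ᶠ x in residual X, ∀ᶠ g in residual G, p (x, g) := by
  obtain ⟨S, hSo, hSd, hSc, hS⟩ := mem_residual_iff.1 h
  -- A section of a dense open set is open, and it is dense once it meets each basic open `B`; for
  -- fixed `B` this is a dense open condition on `x`.
  have key : ∀ O ∈ S, ∀ᶠ x in residual X, ∀ᶠ g in residual G, (x, g) ∈ O := by
    intro O hO
    have hB := TopologicalSpace.isBasis_countableBasis G
    have h1 : ∀ᶠ x in residual X, ∀ B ∈ TopologicalSpace.countableBasis G,
        ∃ g ∈ B, (x, g) ∈ O := by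
      rw [eventually_countable_ball (TopologicalSpace.countable_countableBasis G)]
      intro B hBB
      have hBo := TopologicalSpace.isOpen_of_mem_countableBasis hBB
      refine residual_of_dense_open ?_ ?_
      · exact isOpen_setOf_exists_mem (hSo O hO) hBo
      · rw [dense_iff_inter_open]
        intro U hU hUne
        obtain ⟨⟨x, g⟩, ⟨hxU, hgB⟩, hxO⟩ := (hSd O hO).inter_open_nonempty _ (hU.prod hBo)
          (hUne.prod (TopologicalSpace.nonempty_of_mem_countableBasis hBB))
        exact ⟨x, hxU, g, hgB, hxO⟩
    filter_upwards [h1] with x hx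
    refine residual_of_dense_open ((hSo O hO).preimage (by fun_prop : Continuous fun g => (x, g))) ?_
    rw [hB.dense_iff]
    intro B hBB _
    obtain ⟨g, hg, hxg⟩ := hx B hBB
    exact ⟨g, hg, hxg⟩
  have h2 := (eventually_countable_ball hSc).2 key
  filter_upwards [h2] with x hx
  filter_upwards [(eventually_countable_ball hSc).2 hx] with g hg
  exact hS (mem_sInter.2 hg)

/-- An open section is generic in `V` exactly when it meets every nonempty basic open subset of `V`,
which amounts to countably many open conditions on `x`. -/
theorem isGδ_setOf_eventually_residual [SecondCountableTopology G] [BaireSpace G]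
    {O : Set (X × G)} (hO : IsOpen O) {V : Set G} (hV : IsOpen V) :
    IsGδ {x | ∀ᶠ g in residual G, g ∈ V → (x, g) ∈ O} := by
  have hB := TopologicalSpace.isBasis_countableBasis G
  have heq : {x | ∀ᶠ g in residual G, g ∈ V → (x, g) ∈ O} =
      ⋂ B ∈ {B ∈ TopologicalSpace.countableBasis G | B ⊆ V}, {x | ∃ g ∈ B, (x, g) ∈ O} := by
    ext x
    rw [mem_iInter₂]
    constructor
    · rintro h B ⟨hBB, hBV⟩
      obtain ⟨g, hgB, hg⟩ := (dense_of_mem_residual h).inter_open_nonempty B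
        (TopologicalSpace.isOpen_of_mem_countableBasis hBB)
        (TopologicalSpace.nonempty_of_mem_countableBasis hBB)
      exact ⟨g, hgB, hg (hBV hgB)⟩
    · intro h
      have hOx : IsOpen {g | (x, g) ∈ O} := hO.preimage (by fun_prop : Continuous fun g => (x, g))
      have : {g | (x, g) ∈ O} ∪ (closure V)ᶜ ∈ residual G := by
        refine residual_of_dense_open (hOx.union isClosed_closure.isOpen_compl) ?_
        rw [dense_iff_inter_open]
        rintro N hN ⟨a, ha⟩
        by_cases hav : a ∈ closure V
        · obtain ⟨b, hbN, hbV⟩ := mem_closure_iff.1 hav N hN ha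
          obtain ⟨B, hBB, -, hBN⟩ := hB.exists_subset_of_mem_open
            (⟨hbN, hbV⟩ : b ∈ N ∩ V) (hN.inter hV)
          obtain ⟨g, hg, hxg⟩ := h B ⟨hBB, fun y hy => (hBN hy).2⟩
          exact ⟨g, (hBN hg).1, Or.inl hxg⟩
        · exact ⟨a, ha, Or.inr hav⟩
      filter_upwards [this] with g hg hgV
      exact hg.resolve_right fun h => h (subset_closure hgV)
  rw [heq]
  refine IsGδ.biInter ((TopologicalSpace.countable_countableBasis G).mono fun _ h => h.1) ?_
  rintro B ⟨hBB, -⟩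
  exact (isOpen_setOf_exists_mem hO (TopologicalSpace.isOpen_of_mem_countableBasis hBB)).isGδ

theorem IsGδ.baireMeasurableSet {s : Set X} (hs : IsGδ s) : BaireMeasurableSet s := by
  borelize X
  exact hs.measurableSet.baireMeasurableSet

/-- `A` agrees with an open set modulo a meagre set. By Kuratowski–Ulam their sections agree
generically for generic `x`, which reduces the claim to the open case. -/
theorem BaireMeasurableSet.setOf_eventually_residual [SecondCountableTopology G] [BaireSpace G]
    {A : Set (X × G)} (hA : BaireMeasurableSet A) {V : Set G} (hV : IsOpen V) :
    BaireMeasurableSet {x | ∀ᶠ g in residual G, g ∈ V → (x, g) ∈ A} := by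
  obtain ⟨O, hO, hAO⟩ := hA.residualEq_isOpen
  refine (isGδ_setOf_eventually_residual hO hV).baireMeasurableSet.congr ?_
  rw [Filter.eventuallyEq_set] at hAO ⊢
  filter_upwards [hAO.residual_section] with x hx
  refine eventually_congr ?_
  filter_upwards [hx] with g hg
  rw [hg]

/-- Discarding countably many meagre sets makes the preimage of every basic open set relatively
open. -/
theorem BaireMeasurableMap.exists_continuousOn {Y : Type*} [TopologicalSpace Y]
    [SecondCountableTopology Y] [BaireSpace X] {f : X → Y} (hf : BaireMeasurableMap f) :
    ∃ C : Set X, IsGδ C ∧ Dense C ∧ ContinuousOn f C := by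
  have hB := TopologicalSpace.isBasis_countableBasis Y
  choose! O hO hfO using fun (B : Set Y) (hBB : B ∈ TopologicalSpace.countableBasis Y) =>
    (hf B (TopologicalSpace.isOpen_of_mem_countableBasis hBB)).residualEq_isOpen
  have h : ∀ᶠ x in residual X, ∀ B ∈ TopologicalSpace.countableBasis Y, (f x ∈ B ↔ x ∈ O B) := by
    rw [eventually_countable_ball (TopologicalSpace.countable_countableBasis Y)]
    intro B hBB
    exact Filter.eventuallyEq_set.1 (hfO B hBB)
  obtain ⟨C, hCG, hCd, hC⟩ := eventually_residual.1 h
  refine ⟨C, hCG, hCd, fun x hx => ?_⟩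
  rw [ContinuousWithinAt, hB.nhds_hasBasis.tendsto_right_iff]
  rintro B ⟨hBB, hxB⟩
  filter_upwards [mem_nhdsWithin_of_mem_nhds ((hO B hBB).mem_nhds ((hC x hx B hBB).1 hxB)),
    self_mem_nhdsWithin] with y hy hyC
  exact (hC y hyC B hBB).2 hy

end Category

/-! ### Genericity along orbits. -/

section Action

theorem Filter.Eventually.residual_mul_right {G : Type*} [Group G] [TopologicalSpace G]
    [SeparatelyContinuousMul G] {p : G → Prop} (h : ∀ᶠ g in residual G, p g)
    (a : G) : ∀ᶠ g in residual G, p (g * a) :=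
  (tendsto_residual_of_isOpenMap (continuous_mul_const a) (isOpenMap_mul_right a)).eventually h

/-- The points whose orbits meet `C` generically. -/
def genericSaturation (G : Type*) {X : Type*} [TopologicalSpace G] [SMul G X]
    (C : Set X) : Set X :=
  {x | ∀ᶠ g in residual G, g • x ∈ C}

theorem smul_mem_genericSaturation {G X : Type*} [Group G] [TopologicalSpace G]
    [SeparatelyContinuousMul G] [MulAction G X] {C : Set X} (g : G) {x : X}
    (hx : x ∈ genericSaturation G C) : g • x ∈ genericSaturation G C := by
  have := Filter.Eventually.residual_mul_right hx g
  simp only [mul_smul] at this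
  exact this

variable {G X : Type*} [Group G] [TopologicalSpace G] [TopologicalSpace X] [MulAction G X]
  [ContinuousSMul G X]

theorem isOpenMap_smul_prod : IsOpenMap fun p : X × G => p.2 • p.1 := by
  intro O hO
  rw [isOpen_iff_forall_mem_open]
  rintro _ ⟨⟨x, g⟩, hxg, rfl⟩
  refine ⟨{y | (g⁻¹ • y, g) ∈ O}, fun y hy => ⟨_, hy, smul_inv_smul g y⟩,
    hO.preimage ((continuous_const_smul g⁻¹).prodMk continuous_const), ?_⟩
  simpa using hxg

theorem tendsto_smul_residual :
    Tendsto (fun p : X × G => p.2 • p.1) (residual (X × G)) (residual X) :=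
  tendsto_residual_of_isOpenMap (by fun_prop) isOpenMap_smul_prod

theorem Filter.Eventually.residual_smul [SecondCountableTopology G] {p : X → Prop}
    (h : ∀ᶠ x in residual X, p x) : ∀ᶠ x in residual X, ∀ᶠ g in residual G, p (g • x) :=
  (tendsto_smul_residual.eventually h).residual_section

/-- Otherwise `Eᶜ` would be comeagre in a nonempty open `O`. For generic `x ∈ O` and generic `g` in
the nonempty open set `{g | g • x ∈ O}`, the point `g • x` would lie both in `E` and in `Eᶜ`. -/
theorem BaireMeasurableSet.eventually_of_smul [SecondCountableTopology G] [BaireSpace G]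
    [BaireSpace X] {E : Set X} (hE : BaireMeasurableSet E)
    (h : ∀ᶠ x in residual X, ∀ᶠ g in residual G, g • x ∈ E) : ∀ᶠ x in residual X, x ∈ E := by
  have key : IsMeagre Eᶜ := by
    refine hE.compl.isMeagre_of_forall_isOpen fun O hO hne hm => ?_
    have hm' : ∀ᶠ x in residual X, ¬ (x ∈ O ∧ x ∉ Eᶜ) := hm
    obtain ⟨x, hxO, hx⟩ := (dense_of_mem_residual
      (h.and (hm'.residual_smul (G := G)))).inter_open_nonempty O hO hne
    obtain ⟨g, hgO, hg⟩ := (dense_of_mem_residual (hx.1.and hx.2)).inter_open_nonempty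
      {g | g • x ∈ O} (hO.preimage (continuous_id.smul continuous_const)) ⟨1, by simpa using hxO⟩
    exact hg.2 ⟨hgO, fun hc => hc hg.1⟩
  rwa [IsMeagre, compl_compl] at key

theorem dense_genericSaturation [SecondCountableTopology G] [BaireSpace X] {C : Set X}
    (hC : C ∈ residual X) : Dense (genericSaturation G C) :=
  dense_of_mem_residual (Filter.Eventually.residual_smul hC)

theorem IsGδ.genericSaturation [SecondCountableTopology G] [BaireSpace G] {C : Set X}
    (hC : IsGδ C) : IsGδ (genericSaturation G C) := by
  obtain ⟨O, hO, rfl⟩ := isGδ_iff_eq_iInter_nat.1 hC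
  have : _root_.genericSaturation G (⋂ n, O n) =
      ⋂ n, {x | ∀ᶠ g in residual G, g ∈ univ → (x, g) ∈ (fun p : X × G => p.2 • p.1) ⁻¹' O n} := by
    ext x
    have h : (∀ᶠ g in residual G, ∀ n, g • x ∈ O n) ↔ ∀ n, ∀ᶠ g in residual G, g • x ∈ O n :=
      eventually_countable_forall
    simpa [_root_.genericSaturation] using h
  rw [this]
  exact IsGδ.iInter fun n =>
    isGδ_setOf_eventually_residual ((hO n).preimage (by fun_prop)) isOpen_univ

end Action

/-! ### Local control of an orbit homomorphism by small group elements. -/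

section OrbitHom

variable {G H X Y : Type*}
  [Group G] [TopologicalSpace G] [PolishSpace G]
  [Group H] [TopologicalSpace H] [PolishSpace H]
  [TopologicalSpace X] [PolishSpace X] [MulAction G X] [ContinuousSMul G X]
  [TopologicalSpace Y] [PolishSpace Y] [MulAction H Y] [ContinuousSMul H Y]

/-- The pairs `(x, g)` for which `f (g • x)` is a translate of `f x` by an element of `N`. -/
def translatePairs (G : Type*) {H X Y : Type*} [SMul G X] [SMul H Y] (f : X → Y) (N : Set H) :
    Set (X × G) :=
  {p | ∃ h ∈ N, f (p.2 • p.1) = h • f p.1}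

/-- For generic pairs both `x` and `g • x` lie in `C`, where `f` agrees with a Borel map `F`. With
`F` in place of `f`, the set is the projection along `H` of a Borel set, hence analytic. -/
theorem baireMeasurableSet_translatePairs {f : X → Y} {C : Set X} (hC : IsGδ C) (hCd : Dense C)
    (hf : ContinuousOn f C) {N : Set H} (hN : IsOpen N) :
    BaireMeasurableSet (translatePairs G f N) := by
  classical
  rcases isEmpty_or_nonempty Y with hY | ⟨⟨y₀⟩⟩
  · convert isOpen_empty.baireMeasurableSet
    ext p
    exact (hY.false (f p.1)).elim
  borelize X G H Y
  set F : X → Y := C.piecewise f (fun _ => y₀) with hFdef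
  have hF : Measurable F := hf.measurable_piecewise continuousOn_const hC.measurableSet
  have hFC : ∀ x ∈ C, F x = f x := fun x hx => piecewise_eq_of_mem _ _ _ hx
  set D : Set (X × G) := Prod.fst ⁻¹' C ∩ (fun p : X × G => p.2 • p.1) ⁻¹' C with hD
  have hDG : IsGδ D := (hC.preimage continuous_fst).inter (hC.preimage (by fun_prop))
  have hDr : D ∈ residual (X × G) := by
    have hCr := residual_of_dense_Gδ hC hCd
    exact Filter.inter_mem
      (tendsto_residual_of_isOpenMap continuous_fst isOpenMap_fst hCr)
      (tendsto_smul_residual hCr)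
  have hB : MeasurableSet {q : (X × G) × H | (q.1 ∈ D ∧ q.2 ∈ N) ∧
      F (q.1.2 • q.1.1) = q.2 • F q.1.1} := by
    refine ((hDG.measurableSet.preimage measurable_fst).inter
      (hN.measurableSet.preimage measurable_snd)).inter (measurableSet_eq_fun ?_ ?_)
    · exact hF.comp (by fun_prop : Continuous fun q : (X × G) × H => q.1.2 • q.1.1).measurable
    · exact (continuous_smul : Continuous fun r : H × Y => r.1 • r.2).measurable.comp
        (measurable_snd.prodMk (hF.comp (measurable_fst.comp measurable_fst)))
  have hA := (hB.analyticSet.image_of_continuous continuous_fst).baireMeasurableSet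
  refine hA.congr ?_
  rw [Filter.eventuallyEq_set]
  filter_upwards [hDr] with p hp
  constructor
  · rintro ⟨⟨q, h⟩, ⟨⟨-, hh⟩, he⟩, rfl⟩
    refine ⟨h, hh, ?_⟩
    rwa [← hFC _ hp.1, ← hFC _ hp.2]
  · rintro ⟨h, hh, he⟩
    refine ⟨(p, h), ⟨⟨hp, hh⟩, ?_⟩, rfl⟩
    change F (p.2 • p.1) = h • F p.1
    rwa [hFC _ hp.1, hFC _ hp.2]

/-- The property is established at `g₀ • x` for generic `x` and generic `g₀`; it defines a set with
the property of Baire, so it then holds at generic points. -/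
theorem eventually_exists_translatePairs [IsTopologicalGroup G] [IsTopologicalGroup H]
    {f : X → Y} {C : Set X} (hC : IsGδ C) (hCd : Dense C)
    (hf : ContinuousOn f C) (hE : IsOrbitHom G H f) {W : Set H} (hW : IsOpen W) (h1 : (1 : H) ∈ W) :
    ∀ᶠ x in residual X, ∃ B ∈ TopologicalSpace.countableBasis G, (1 : G) ∈ B ∧
      ∀ᶠ g in residual G, g ∈ B → (x, g) ∈ translatePairs G f W := by
  have hbm : BaireMeasurableSet {x | ∃ B ∈ TopologicalSpace.countableBasis G, (1 : G) ∈ B ∧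
      ∀ᶠ g in residual G, g ∈ B → (x, g) ∈ translatePairs G f W} := by
    have heq : {x | ∃ B ∈ TopologicalSpace.countableBasis G, (1 : G) ∈ B ∧
        ∀ᶠ g in residual G, g ∈ B → (x, g) ∈ translatePairs G f W} =
        ⋃ B ∈ {B ∈ TopologicalSpace.countableBasis G | (1 : G) ∈ B},
          {x | ∀ᶠ g in residual G, g ∈ B → (x, g) ∈ translatePairs G f W} := by
      ext x
      rw [mem_iUnion₂]
      exact ⟨fun ⟨B, h, h', h''⟩ => ⟨B, ⟨h, h'⟩, h''⟩, fun ⟨B, ⟨h, h'⟩, h''⟩ => ⟨B, h, h', h''⟩⟩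
    rw [heq]
    refine BaireMeasurableSet.biUnion
      ((TopologicalSpace.countable_countableBasis G).mono fun _ h => h.1) fun B hB => ?_
    exact (baireMeasurableSet_translatePairs hC hCd hf hW).setOf_eventually_residual
      (TopologicalSpace.isOpen_of_mem_countableBasis hB.1)
  refine hbm.eventually_of_smul (G := G) ?_
  -- If `a` and `h` lie in the same `W₀ * d n`, then `a * h⁻¹ ∈ W`.
  obtain ⟨W₀, hW₀, h1₀, hWW⟩ : ∃ W₀ : Set H, IsOpen W₀ ∧ 1 ∈ W₀ ∧
      ∀ a ∈ W₀, ∀ b ∈ W₀, a * b⁻¹ ∈ W := by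
    have hc : Continuous fun p : H × H => p.1 * p.2⁻¹ := by fun_prop
    have hn : (fun p : H × H => p.1 * p.2⁻¹) ⁻¹' W ∈ 𝓝 ((1 : H), (1 : H)) :=
      (hW.preimage hc).mem_nhds (by simpa using h1)
    rw [nhds_prod_eq, mem_prod_same_iff] at hn
    obtain ⟨t, ht, htW⟩ := hn
    obtain ⟨W₀, hsub, ho, hm⟩ := mem_nhds_iff.1 ht
    exact ⟨W₀, ho, hm, fun a ha b hb => htW (mk_mem_prod (hsub ha) (hsub hb))⟩
  set d := TopologicalSpace.denseSeq H
  have hNo : ∀ n, IsOpen ((fun h => h * (d n)⁻¹) ⁻¹' W₀) := fun n => hW₀.preimage (by fun_prop)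
  choose O hO hAO using fun n => (baireMeasurableSet_translatePairs (G := G) hC hCd hf
    (hNo n)).residualEq_isOpen
  have hev : ∀ᶠ p in residual (X × G), ∀ n,
      (p ∈ translatePairs G f ((fun h => h * (d n)⁻¹) ⁻¹' W₀) ↔ p ∈ O n) :=
    eventually_countable_forall.2 fun n => Filter.eventuallyEq_set.1 (hAO n)
  filter_upwards [hev.residual_section] with x hx
  filter_upwards [hx] with g₀ hg₀
  obtain ⟨h, hh⟩ : ∃ h : H, h • f x = f (g₀ • x) := hE _ _ ⟨g₀, rfl⟩
  obtain ⟨_, hdn, n, rfl⟩ := (TopologicalSpace.denseRange_denseSeq H).inter_open_nonempty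
    {k | h * k⁻¹ ∈ W₀} (hW₀.preimage (by fun_prop)) ⟨h, by simpa using h1₀⟩
  have hgO : (x, g₀) ∈ O n := (hg₀ n).1 ⟨h, hdn, hh.symm⟩
  obtain ⟨B, hB, h1B, hBO⟩ := (TopologicalSpace.isBasis_countableBasis G).exists_subset_of_mem_open
    (show (1 : G) ∈ {k | (x, k * g₀) ∈ O n} by simpa using hgO)
    ((hO n).preimage (by fun_prop))
  refine ⟨B, hB, h1B, ?_⟩
  filter_upwards [hx.residual_mul_right g₀] with k hk hkB
  obtain ⟨a, ha, hae⟩ := (hk n).2 (hBO hkB)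
  -- Here `f (g₀ • x) = h • f x` and `f ((k * g₀) • x) = a • f x`.
  refine ⟨a * h⁻¹, ?_, ?_⟩
  · have heq : a * (d n)⁻¹ * (h * (d n)⁻¹)⁻¹ = a * h⁻¹ := by group
    exact heq ▸ hWW _ ha _ hdn
  · change f (k • g₀ • x) = _
    have hae' : f ((k * g₀) • x) = a • f x := hae
    rw [← hh, mul_smul, inv_smul_smul, ← hae', mul_smul]

/-- Uniformity in `x` near `x₀` comes from the property of Baire: on a suitable dense Gδ set each of
the countably many sets `D W B` coincides with an open set, so membership of `x₀` spreads to a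
neighborhood. -/
theorem exists_locally_translating [IsTopologicalGroup G] [IsTopologicalGroup H]
    {f : X → Y} (hf : BaireMeasurableMap f) (hE : IsOrbitHom G H f) :
    ∃ C : Set X, IsGδ C ∧ Dense C ∧ ContinuousOn f C ∧
      ∀ x₀ ∈ C, ∀ W : Set H, IsOpen W → 1 ∈ W → ∃ (U : Set X) (V : Set G),
        IsOpen U ∧ x₀ ∈ U ∧ IsOpen V ∧ 1 ∈ V ∧ ∀ x ∈ U ∩ C,
          ∀ᶠ g in residual G, g ∈ V → ∃ w ∈ W, f (g • x) = w • f x := by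
  obtain ⟨C, hC, hCd, hfC⟩ := hf.exists_continuousOn
  set D : Set H → Set G → Set X := fun W B =>
    {x | ∀ᶠ g in residual G, g ∈ B → (x, g) ∈ translatePairs G f W} with hD
  have hBM : ∀ W ∈ TopologicalSpace.countableBasis H, ∀ B ∈ TopologicalSpace.countableBasis G,
      BaireMeasurableSet (D W B) := fun W hW B hB =>
    (baireMeasurableSet_translatePairs hC hCd hfC
      (TopologicalSpace.isOpen_of_mem_countableBasis hW)).setOf_eventually_residual
        (TopologicalSpace.isOpen_of_mem_countableBasis hB)
  choose! O hO hDO using fun W hW B hB => (hBM W hW B hB).residualEq_isOpen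
  have e1 : ∀ᶠ x in residual X, ∀ W ∈ TopologicalSpace.countableBasis H,
      ∀ B ∈ TopologicalSpace.countableBasis G, (x ∈ D W B ↔ x ∈ O W B) := by
    rw [eventually_countable_ball (TopologicalSpace.countable_countableBasis H)]
    intro W hW
    rw [eventually_countable_ball (TopologicalSpace.countable_countableBasis G)]
    exact fun B hB => Filter.eventuallyEq_set.1 (hDO W hW B hB)
  have e2 : ∀ᶠ x in residual X, ∀ W ∈ TopologicalSpace.countableBasis H, 1 ∈ W →
      ∃ B ∈ TopologicalSpace.countableBasis G, (1 : G) ∈ B ∧ x ∈ D W B := by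
    rw [eventually_countable_ball (TopologicalSpace.countable_countableBasis H)]
    intro W hW
    by_cases h1 : (1 : H) ∈ W
    · filter_upwards [eventually_exists_translatePairs hC hCd hfC hE
        (TopologicalSpace.isOpen_of_mem_countableBasis hW) h1] with x hx _
      exact hx
    · exact Eventually.of_forall fun x h => absurd h h1
  obtain ⟨C', hC', hCd', h⟩ := eventually_residual.1
    ((show ∀ᶠ x in residual X, x ∈ C from residual_of_dense_Gδ hC hCd).and (e1.and e2))
  refine ⟨C', hC', hCd', hfC.mono fun x hx => (h x hx).1, fun x₀ hx₀ W hW h1 => ?_⟩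
  obtain ⟨W', hW', h1', hWW⟩ :=
    (TopologicalSpace.isBasis_countableBasis H).exists_subset_of_mem_open h1 hW
  obtain ⟨B, hB, h1B, hxB⟩ := (h x₀ hx₀).2.2 W' hW' h1'
  refine ⟨O W' B, B, hO W' hW' B hB, ((h x₀ hx₀).2.1 W' hW' B hB).1 hxB,
    TopologicalSpace.isOpen_of_mem_countableBasis hB, h1B, ?_⟩
  rintro x ⟨hxO, hxC⟩
  have hxD : ∀ᶠ g in residual G, g ∈ B → (x, g) ∈ translatePairs G f W' :=
    ((h x hxC).2.1 W' hW' B hB).2 hxO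
  filter_upwards [hxD] with g hg hgB
  obtain ⟨w, hw, he⟩ := hg hgB
  exact ⟨w, hWW hw, he⟩

end OrbitHom

/-! ### Winning strategies as back-and-forth systems of positions. -/

section Game

variable {G X : Type*}

theorem prodUpTo_congr [Mul G] {h h' : ℕ → G} {k : ℕ} (H : ∀ i ≤ k, h i = h' i) :
    prodUpTo h k = prodUpTo h' k := by
  induction k with
  | zero => exact H 0 le_rfl
  | succ k ih => rw [prodUpTo, prodUpTo, H _ le_rfl, ih fun i hi => H i (hi.trans k.le_succ)]

theorem visited_congr [SMul G X] {g g' : ℕ → G} {z : X} {n : ℕ} (H : ∀ i < n, g i = g' i) :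
    visited g z n = visited g' z n := by
  induction n with
  | zero => rfl
  | succ n ih => rw [visited, visited, H _ n.lt_succ_self, ih fun i hi => H i (hi.trans n.lt_succ_self)]

theorem IsLocalProduct.mono [Mul G] [SMul G X] {U U' : Set X} {V V' : Set G} {z : X} {g : G}
    (hg : IsLocalProduct U V z g) (hU : U ⊆ U') (hV : V ⊆ V') : IsLocalProduct U' V' z g := by
  obtain ⟨k, h, rfl, hh⟩ := hg
  exact ⟨k, h, rfl, fun i hi => ⟨hV (hh i hi).1, hU (hh i hi).2⟩⟩

theorem isLocalProduct_of_mem [Mul G] [SMul G X] {U : Set X} {V : Set G} {z : X} {g : G}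
    (hg : g ∈ V) (hU : g • z ∈ U) : IsLocalProduct U V z g := by
  refine ⟨0, fun _ => g, rfl, fun i hi => ?_⟩
  obtain rfl : i = 0 := by omega
  exact ⟨hg, hU⟩

theorem IsLocalProduct.mul_left [Mul G] [SMul G X] {U : Set X} {V : Set G} {z : X} {g h : G}
    (hg : IsLocalProduct U V z g) (hh : h ∈ V) (hU : (h * g) • z ∈ U) :
    IsLocalProduct U V z (h * g) := by
  obtain ⟨k, p, rfl, hp⟩ := hg
  have hk : ∀ i ≤ k, prodUpTo (fun i => if i ≤ k then p i else h) i = prodUpTo p i :=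
    fun i hi => prodUpTo_congr fun j hj => if_pos (hj.trans hi)
  have hk' : prodUpTo (fun i => if i ≤ k then p i else h) (k + 1) = h * prodUpTo p k := by
    rw [prodUpTo, hk k le_rfl, if_neg (by omega)]
  refine ⟨k + 1, fun i => if i ≤ k then p i else h, hk'.symm, fun i hi => ?_⟩
  rcases Nat.lt_or_ge k i with hik | hik
  · obtain rfl : i = k + 1 := by omega
    rw [hk']
    exact ⟨by simpa using hh, hU⟩
  · rw [hk i hik]
    simpa only [if_pos hik] using hp i hik

theorem IsLocalProduct.induction [Mul G] [SMul G X] {U : Set X} {V : Set G} {z : X}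
    {P : G → Prop} (base : ∀ g ∈ V, g • z ∈ U → P g)
    (step : ∀ g, P g → ∀ h ∈ V, (h * g) • z ∈ U → P (h * g))
    {g : G} (hg : IsLocalProduct U V z g) : P g := by
  obtain ⟨k, p, rfl, hp⟩ := hg
  induction k with
  | zero => exact base _ (hp 0 le_rfl).1 (hp 0 le_rfl).2
  | succ k ih =>
    exact step _ (ih fun i hi => hp i (hi.trans k.le_succ)) _ (hp _ le_rfl).1 (hp _ le_rfl).2

theorem HjorthStrategy.gY_congr (σ : HjorthStrategy G X) {mx my mx' my' : ℕ → Set X × Set G}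
    {n : ℕ} (hx : ∀ i ≤ n, mx i = mx' i) (hy : ∀ i ≤ n, my i = my' i) :
    σ.gY mx my n = σ.gY mx' my' n := by
  unfold HjorthStrategy.gY
  congr 1
  · funext i; exact hx i (by omega)
  · funext i; exact hy i (by omega)

theorem HjorthStrategy.gX_congr (σ : HjorthStrategy G X) {mx my mx' my' : ℕ → Set X × Set G}
    {n : ℕ} (hx : ∀ i ≤ n, mx i = mx' i) (hy : ∀ i ≤ n + 1, my i = my' i) :
    σ.gX mx my n = σ.gX mx' my' n := by
  unfold HjorthStrategy.gX
  congr 1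
  · funext i; exact hx i (by omega)
  · funext i; exact hy i (by omega)

theorem legalMove_univ [One G] [TopologicalSpace G] [TopologicalSpace X] (z : X) :
    LegalMove z ((univ, univ) : Set X × Set G) :=
  ⟨⟨isOpen_univ, trivial⟩, isOpen_univ, trivial⟩

/-- Extend a finite sequence of moves by the trivial move. -/
def extendMoves {n : ℕ} (m : Fin n → Set X × Set G) (i : ℕ) : Set X × Set G :=
  if h : i < n then m ⟨i, h⟩ else (univ, univ)

theorem extendMoves_of_lt {n i : ℕ} (m : ℕ → Set X × Set G) (h : i < n) :
    extendMoves (fun i : Fin n => m i) i = m i :=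
  dif_pos h

variable [Group G] [MulAction G X]

theorem pullMove_pullMove (a b : G) (m : Set X × Set G) :
    pullMove a (pullMove b m) = pullMove (b * a) m := by
  simp only [pullMove, preimage_preimage, mul_smul, mul_inv_rev, mul_assoc]

open Classical in
/-- A reply of Player II that stays in the set of positions `S`, if there is one. -/
noncomputable def backAndForthReply (S : X → X → Set X × Set G → Prop) (a b : X)
    (m m' : Set X × Set G) : G :=
  -- The default `1` is never used while the play stays in a back-and-forth set and Player I moves
  -- legally.
  if h : ∃ g : G, IsLocalProduct m.1 m.2 b g ∧ g • b ∈ m'.1 ∧ S (g • b) a m' then h.choose else 1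

/-- The points `(xₙ, yₙ)` reached when Player II plays according to `backAndForthReply S`. -/
noncomputable def backAndForthPos (S : X → X → Set X × Set G → Prop) (x y : X)
    (mx my : ℕ → Set X × Set G) : ℕ → X × X
  | 0 => (x, y)
  | n + 1 =>
    let p := backAndForthPos S x y mx my n
    let y' := backAndForthReply S p.1 p.2 (my n) (mx n) • p.2
    (backAndForthReply S y' p.1 (mx n) (my (n + 1)) • p.1, y')

/-- This makes the padding of a finite history by trivial moves harmless. -/
theorem backAndForthPos_congr (S : X → X → Set X × Set G → Prop) (x y : X)
    {mx my mx' my' : ℕ → Set X × Set G} {n : ℕ} (hx : ∀ i < n, mx i = mx' i)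
    (hy : ∀ i ≤ n, my i = my' i) :
    backAndForthPos S x y mx my n = backAndForthPos S x y mx' my' n := by
  induction n with
  | zero => rfl
  | succ n ih =>
    simp only [backAndForthPos, ih (fun i hi => hx i (by omega)) (fun i hi => hy i (by omega)),
      hx n (by omega), hy n (by omega), hy (n + 1) le_rfl]

/-- Player II plays so as to stay in the set of positions `S`. -/
noncomputable def backAndForthStrategy (S : X → X → Set X × Set G → Prop) (x y : X) :
    HjorthStrategy G X where
  replyY n mx my :=
    let p := backAndForthPos S x y (extendMoves mx) (extendMoves my) n
    backAndForthReply S p.1 p.2 (extendMoves my n) (extendMoves mx n)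
  replyX n mx my :=
    let p := backAndForthPos S x y (extendMoves mx) (extendMoves my) n
    backAndForthReply S
      (backAndForthReply S p.1 p.2 (extendMoves my n) (extendMoves mx n) • p.2) p.1
      (extendMoves mx n) (extendMoves my (n + 1))

variable [TopologicalSpace G] [TopologicalSpace X]

/-- A set of positions `(a, b, m)` in which Player II can stay forever: when `m` is the pending move
of Player I at `b`, every legal move `m'` at `a` has a reply `g` that obeys `m` and `m'` and leads
to the position `(g • b, a, m')`. -/
def IsBackAndForth (S : X → X → Set X × Set G → Prop) : Prop :=
  ∀ a b m, S a b m → ∀ m', LegalMove a m' →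
    ∃ g : G, IsLocalProduct m.1 m.2 b g ∧ g • b ∈ m'.1 ∧ S (g • b) a m'

/-- The set consists of the positions reached in legal runs against a winning strategy, the two
points exchanging roles at each turn. A new move `m'` is answered by cutting the run at the present
turn, inserting `m'` and continuing with trivial moves: these are always legal, and the past is
unchanged. -/
theorem HjorthIso.exists_isBackAndForth {x y : X} (h : HjorthIso G x y) :
    ∃ S : X → X → Set X × Set G → Prop, IsBackAndForth S ∧ S x y (univ, univ) := by
  obtain ⟨σ, hσ⟩ := h
  refine ⟨fun a b m => ∃ mx my n, HjorthLegal x y mx my (σ.gX mx my) (σ.gY mx my) ∧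
    ((a = visited (σ.gX mx my) x n ∧ b = visited (σ.gY mx my) y n ∧ m = my n) ∨
    (a = visited (σ.gY mx my) y (n + 1) ∧ b = visited (σ.gX mx my) x n ∧ m = mx n)), ?_,
    fun _ => (univ, univ), fun _ => (univ, univ), 0,
    ⟨rfl, fun n => ⟨legalMove_univ _, legalMove_univ _⟩⟩, Or.inl ⟨rfl, rfl, rfl⟩⟩
  rintro _ _ _ ⟨mx, my, n, hL, ⟨rfl, rfl, rfl⟩ | ⟨rfl, rfl, rfl⟩⟩ m' hm'
  · set mx' : ℕ → Set X × Set G := fun i => if i < n then mx i else if i = n then m' else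
      (univ, univ) with hmx'
    set my' : ℕ → Set X × Set G := fun i => if i ≤ n then my i else (univ, univ) with hmy'
    have ex : ∀ i < n, mx i = mx' i := fun i hi => (if_pos hi).symm
    have exn : mx' n = m' := by simp [hmx']
    have ey : ∀ i ≤ n, my i = my' i := fun i hi => (if_pos hi).symm
    have vx : ∀ i ≤ n, visited (σ.gX mx my) x i = visited (σ.gX mx' my') x i := fun i hi =>
      visited_congr fun j hj => σ.gX_congr (fun l hl => ex l (by omega))
        (fun l hl => ey l (by omega))
    have vy : ∀ i ≤ n, visited (σ.gY mx my) y i = visited (σ.gY mx' my') y i := fun i hi =>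
      visited_congr fun j hj => σ.gY_congr (fun l hl => ex l (by omega))
        (fun l hl => ey l (by omega))
    have hL' : HjorthLegal x y mx' my' (σ.gX mx' my') (σ.gY mx' my') := by
      refine ⟨by rw [← ey 0 n.zero_le, hL.1], fun i => ⟨?_, ?_⟩⟩
      · rcases lt_trichotomy i n with hi | rfl | hi
        · rw [← ex i hi, ← vx i hi.le]
          exact (hL.2 i).1
        · rw [exn, ← vx i le_rfl]
          exact hm'
        · have : mx' i = (univ, univ) := by
            simp only [hmx']
            rw [if_neg (by omega), if_neg (by omega)]
          rw [this]
          exact legalMove_univ _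
      · rcases Nat.lt_or_ge n i with hi | hi
        · have : my' i = (univ, univ) := if_neg (by omega)
          rw [this]
          exact legalMove_univ _
        · rw [← ey i hi, ← vy i hi]
          exact (hL.2 i).2
    have hW := hσ mx' my' hL' n
    refine ⟨σ.gY mx' my' n, ?_, ?_, mx', my', n, hL', Or.inr ⟨?_, vx n le_rfl, exn.symm⟩⟩
    · rw [ey n le_rfl, vy n le_rfl]
      exact hW.2.1
    · rw [vy n le_rfl, ← exn]
      exact hW.1.1
    · rw [vy n le_rfl]
      rfl
  · set mx' : ℕ → Set X × Set G := fun i => if i ≤ n then mx i else (univ, univ) with hmx'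
    set my' : ℕ → Set X × Set G := fun i => if i ≤ n then my i else if i = n + 1 then m' else
      (univ, univ) with hmy'
    have ex : ∀ i ≤ n, mx i = mx' i := fun i hi => (if_pos hi).symm
    have ey : ∀ i ≤ n, my i = my' i := fun i hi => (if_pos hi).symm
    have eyn : my' (n + 1) = m' := by simp [hmy']
    have vx : ∀ i ≤ n, visited (σ.gX mx my) x i = visited (σ.gX mx' my') x i := fun i hi =>
      visited_congr fun j hj => σ.gX_congr (fun l hl => ex l (by omega))
        (fun l hl => ey l (by omega))
    have vy : ∀ i ≤ n + 1, visited (σ.gY mx my) y i = visited (σ.gY mx' my') y i := fun i hi =>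
      visited_congr fun j hj => σ.gY_congr (fun l hl => ex l (by omega))
        (fun l hl => ey l (by omega))
    have hL' : HjorthLegal x y mx' my' (σ.gX mx' my') (σ.gY mx' my') := by
      refine ⟨by rw [← ey 0 n.zero_le, hL.1], fun i => ⟨?_, ?_⟩⟩
      · rcases Nat.lt_or_ge n i with hi | hi
        · have : mx' i = (univ, univ) := if_neg (by omega)
          rw [this]
          exact legalMove_univ _
        · rw [← ex i hi, ← vx i hi]
          exact (hL.2 i).1
      · rcases lt_trichotomy i (n + 1) with hi | rfl | hi
        · rw [← ey i (by omega), ← vy i hi.le]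
          exact (hL.2 i).2
        · rw [eyn, ← vy _ le_rfl]
          exact hm'
        · have : my' i = (univ, univ) := by
            simp only [hmy']
            rw [if_neg (by omega), if_neg (by omega)]
          rw [this]
          exact legalMove_univ _
    have hW := hσ mx' my' hL'
    refine ⟨σ.gX mx' my' n, ?_, ?_, mx', my', n + 1, hL', Or.inl ⟨?_, vy _ le_rfl, eyn.symm⟩⟩
    · rw [ex n le_rfl, vx n le_rfl]
      exact (hW n).2.2
    · rw [vx n le_rfl, ← eyn]
      -- The requirement `x_{n+1} ∈ U_{n+1}^y` belongs to the winning condition of index `n + 1`.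
      exact (hW (n + 1)).1.2
    · rw [vx n le_rfl]
      rfl

theorem IsBackAndForth.reply_spec {S : X → X → Set X × Set G → Prop} (hS : IsBackAndForth S)
    {a b : X} {m m' : Set X × Set G} (h : S a b m) (hm' : LegalMove a m') :
    IsLocalProduct m.1 m.2 b (backAndForthReply S a b m m') ∧
      backAndForthReply S a b m m' • b ∈ m'.1 ∧
      S (backAndForthReply S a b m m' • b) a m' := by
  have h' := hS a b m h m' hm'
  rw [backAndForthReply, dif_pos h']
  exact h'.choose_spec

theorem IsBackAndForth.hjorthIso {S : X → X → Set X × Set G → Prop} (hS : IsBackAndForth S)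
    {x y : X} (h : S x y (univ, univ)) : HjorthIso G x y := by
  refine ⟨backAndForthStrategy S x y, fun mx my => ?_⟩
  set P := backAndForthPos S x y mx my with hP
  have hgY : ∀ n, (backAndForthStrategy S x y).gY mx my n =
      backAndForthReply S (P n).1 (P n).2 (my n) (mx n) := by
    intro n
    simp only [HjorthStrategy.gY, backAndForthStrategy]
    rw [extendMoves_of_lt mx n.lt_succ_self, extendMoves_of_lt my n.lt_succ_self,
      backAndForthPos_congr S x y (mx' := mx) (my' := my)
        (fun i hi => extendMoves_of_lt mx (by omega)) (fun i hi => extendMoves_of_lt my (by omega))]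
  have hgX : ∀ n, (backAndForthStrategy S x y).gX mx my n =
      backAndForthReply S (P (n + 1)).2 (P n).1 (mx n) (my (n + 1)) := by
    intro n
    simp only [HjorthStrategy.gX, backAndForthStrategy]
    rw [extendMoves_of_lt mx n.lt_succ_self, extendMoves_of_lt my (by omega),
      extendMoves_of_lt my (by omega),
      backAndForthPos_congr S x y (mx' := mx) (my' := my)
        (fun i hi => extendMoves_of_lt mx (by omega)) (fun i hi => extendMoves_of_lt my (by omega))]
    rfl
  generalize (backAndForthStrategy S x y).gY mx my = gy at hgY ⊢
  generalize (backAndForthStrategy S x y).gX mx my = gx at hgX ⊢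
  have hv : ∀ n, P n = (visited gx x n, visited gy y n) := by
    intro n
    induction n with
    | zero => rfl
    | succ n ih =>
      have h2 : (P (n + 1)).2 = visited gy y (n + 1) := by
        rw [visited, hgY, ih]
        simp only [hP, backAndForthPos] at ih ⊢
        rw [ih]
      refine Prod.ext ?_ h2
      rw [visited, hgX]
      simp only [ih]
      rw [h2, visited, hgY, ih]
      simp only [hP, backAndForthPos] at ih ⊢
      rw [ih]
  simp only [hv] at hgX hgY
  rintro ⟨h0, hL⟩
  have hfirst : ∀ n, S (visited gx x n) (visited gy y n) (my n) →
      IsLocalProduct (my n).1 (my n).2 (visited gy y n) (gy n) ∧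
        visited gy y (n + 1) ∈ (mx n).1 ∧ S (visited gy y (n + 1)) (visited gx x n) (mx n) := by
    intro n hn
    rw [visited, hgY]
    exact hS.reply_spec hn (hL n).1
  have hsecond : ∀ n, S (visited gy y (n + 1)) (visited gx x n) (mx n) →
      IsLocalProduct (mx n).1 (mx n).2 (visited gx x n) (gx n) ∧
        visited gx x (n + 1) ∈ (my (n + 1)).1 ∧
        S (visited gx x (n + 1)) (visited gy y (n + 1)) (my (n + 1)) := by
    intro n hn
    have := hS.reply_spec hn (hL (n + 1)).2
    rwa [← hgX] at this
  have hall : ∀ n, S (visited gx x n) (visited gy y n) (my n) ∧ visited gx x n ∈ (my n).1 := by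
    intro n
    induction n with
    | zero => rw [h0]; exact ⟨h, trivial⟩
    | succ n ih =>
      have := hsecond n (hfirst n ih.1).2.2
      exact ⟨this.2.2, this.2.1⟩
  intro n
  have h1 := hfirst n (hall n).1
  exact ⟨⟨h1.2.1, (hall n).2⟩, h1.1, (hsecond n h1.2.2).1⟩

/-- Closing a back-and-forth set under diagonal translation keeps it back-and-forth: replies are
conjugated. The invariance is what allows the simulated game to be shifted by an error term. -/
theorem HjorthIso.exists_isBackAndForth_invariant [IsTopologicalGroup G] [ContinuousSMul G X]
    {x y : X} (h : HjorthIso G x y) :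
    ∃ S : X → X → Set X × Set G → Prop, IsBackAndForth S ∧ S x y (univ, univ) ∧
      ∀ (c : G) a b m, S a b (pullMove c m) → S (c • a) (c • b) m := by
  obtain ⟨S, hS, hxy⟩ := h.exists_isBackAndForth
  refine ⟨fun a b m => ∃ c : G, S (c • a) (c • b) (pullMove c⁻¹ m), ?_, ⟨1, ?_⟩, ?_⟩
  · rintro a b m ⟨c, hc⟩ m' hm'
    have hl : LegalMove (c • a) (pullMove c⁻¹ m') := LegalMove.pull (by simpa using hm')
    obtain ⟨g, hg, hgb, hSg⟩ := hS _ _ _ hc _ hl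
    have hp := hg.of_pull
    rw [inv_smul_smul] at hp
    have heq : (c⁻¹ * g * c⁻¹⁻¹) • b = c⁻¹ • g • c • b := by simp only [inv_inv, mul_smul]
    refine ⟨_, hp, ?_, c, ?_⟩
    · rw [heq]
      exact hgb
    · rwa [heq, smul_inv_smul]
  · rw [pullMove_univ, one_smul, one_smul]
    exact hxy
  · rintro c a b m ⟨d, hd⟩
    refine ⟨d * c⁻¹, ?_⟩
    rw [pullMove_pullMove] at hd
    simpa [mul_smul] using hd

end Game

/-! ### Transferring a winning strategy along `f`. -/

section Transfer

variable {G H X Y : Type*}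
  [Group G] [TopologicalSpace G] [IsTopologicalGroup G] [BaireSpace G]
  [Group H] [TopologicalSpace X] [MulAction G X] [ContinuousSMul G X] [MulAction H Y]

/-- The image under `f` of a piece of orbit that starts in `U ∩ C` and moves by a generic element
of `V` stays in `U'` and moves by an element of `W`. -/
structure IsGenericallyLocal (f : X → Y) (C : Set X) (U : Set X) (V : Set G) (U' : Set Y)
    (W : Set H) : Prop where
  isOpen_left : IsOpen U
  isOpen_right : IsOpen V
  map_mem : ∀ x ∈ U ∩ C, f x ∈ U'
  eventually_map : ∀ x ∈ U ∩ C, ∀ᶠ g in residual G, g ∈ V →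
    g • x ∈ C ∧ ∃ w ∈ W, f (g • x) = w • f x

/-- Each factor of the product is perturbed to a generic nearby element of `V`; then all
intermediate points lie in `U ∩ C` and `f` turns each factor into an element of `W`. -/
theorem IsGenericallyLocal.exists_isLocalProduct {f : X → Y} {C U : Set X} {V : Set G}
    {U' : Set Y} {W : Set H} (hf : IsGenericallyLocal f C U V U' W) {z : X} (hz : z ∈ U ∩ C)
    {g : G} (hg : IsLocalProduct U V z g) {N : Set G} (hN : IsOpen N) (hgN : g ∈ N) :
    ∃ g' ∈ N, g' • z ∈ U ∩ C ∧ ∃ γ : H, IsLocalProduct U' W (f z) γ ∧ f (g' • z) = γ • f z := by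
  -- The induction needs `N` arbitrary: perturbations of the shorter product must be so small that
  -- one more factor still leads into `N` and `U`.
  revert N
  refine IsLocalProduct.induction
    (P := fun g => ∀ {N : Set G}, IsOpen N → g ∈ N → ∃ g' ∈ N, g' • z ∈ U ∩ C ∧
      ∃ γ : H, IsLocalProduct U' W (f z) γ ∧ f (g' • z) = γ • f z) ?_ ?_ hg
  · intro g hgV hgU N hN hgN
    obtain ⟨k, ⟨⟨hkN, hkV⟩, hkU⟩, hk⟩ := (dense_of_mem_residual
      (hf.eventually_map z hz)).inter_open_nonempty (N ∩ V ∩ {k | k • z ∈ U})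
      ((hN.inter hf.isOpen_right).inter (hf.isOpen_left.preimage (by fun_prop)))
      ⟨g, ⟨hgN, hgV⟩, hgU⟩
    obtain ⟨hkC, w, hw, he⟩ := hk hkV
    refine ⟨k, hkN, ⟨hkU, hkC⟩, w, isLocalProduct_of_mem hw ?_, he⟩
    rw [← he]
    exact hf.map_mem _ ⟨hkU, hkC⟩
  · intro g ih h hhV hhU N hN hgN
    obtain ⟨g', ⟨hg'N, hg'U⟩, hg'z, γ, hγ, hγe⟩ := ih
      (N := {g' | h * g' ∈ N} ∩ {g' | (h * g') • z ∈ U})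
      ((hN.preimage (by fun_prop)).inter (hf.isOpen_left.preimage (by fun_prop))) ⟨hgN, hhU⟩
    -- The last factor `k` is chosen after `g'`, since it must be generic for the point `g' • z`.
    obtain ⟨k, ⟨⟨hkV, hkN⟩, hkU⟩, hk⟩ := (dense_of_mem_residual
      (hf.eventually_map _ hg'z)).inter_open_nonempty
      (V ∩ {k | k * g' ∈ N} ∩ {k | (k * g') • z ∈ U})
      ((hf.isOpen_right.inter (hN.preimage (by fun_prop))).inter
        (hf.isOpen_left.preimage (by fun_prop)))
      ⟨h, ⟨hhV, hg'N⟩, hg'U⟩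
    obtain ⟨hkC, w, hw, he⟩ := hk hkV
    rw [← mul_smul] at hkC he
    have he' : f ((k * g') • z) = (w * γ) • f z := by rw [he, hγe, mul_smul]
    refine ⟨k * g', hkN, ⟨hkU, hkC⟩, w * γ, hγ.mul_left hw ?_, he'⟩
    rw [← he']
    exact hf.map_mem _ ⟨hkU, hkC⟩

variable [TopologicalSpace H] [TopologicalSpace Y]

theorem HjorthIso.map_of_isGenericallyLocal {f : X → Y} (hE : IsOrbitHom G H f) {C : Set X}
    (hC : ∀ x ∈ C, ∀ᶠ g in residual G, g • x ∈ C)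
    (hloc : ∀ x ∈ C, ∀ m' : Set Y × Set H, LegalMove (f x) m' →
      ∃ m : Set X × Set G, LegalMove x m ∧ IsGenericallyLocal f C m.1 m.2 m'.1 m'.2)
    {x y : X} (hx : x ∈ C) (hy : y ∈ C) (h : HjorthIso G x y) : HjorthIso H (f x) (f y) := by
  obtain ⟨T, hT, hTxy, hTinv⟩ := h.exists_isBackAndForth_invariant
  -- The real play is at `f a`, `f b` and the simulated one at `v⁻¹ • a`, `b`, where `v` is the
  -- error of the last perturbation. The simulated pending move `m` is smaller than `(U, V)`,
  -- leaving room for one extra factor `v`.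
  let S : Y → Y → Set Y × Set H → Prop := fun α β μ =>
    ∃ (a b : X) (v : G) (m : Set X × Set G) (U : Set X) (V : Set G),
      a ∈ C ∧ b ∈ C ∧ α = f a ∧ β = f b ∧ T (v⁻¹ • a) b m ∧ b ∈ U ∧ m.1 ⊆ U ∧ m.2 ⊆ V ∧ v ∈ V ∧
      (∀ z ∈ m.1, v • z ∈ U) ∧ IsGenericallyLocal f C U V μ.1 μ.2
  have hS : IsBackAndForth S := by
    rintro _ _ μ ⟨a, b, v, m, U, V, ha, hb, rfl, rfl, hTab, hbU, hmU, hmV, hvV, hvU, hf⟩ μ' hμ'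
    obtain ⟨⟨U', V'⟩, ⟨⟨hU', haU'⟩, hV', h1V'⟩, hf'⟩ := hloc a ha μ' hμ'
    -- `O` is the set played in the simulation, up to the shift by `v`; `N` bounds the next error,
    -- so that it moves `O` into `U'`.
    obtain ⟨N, O, hN, hO, h1N, haO, hNO⟩ : ∃ (N : Set G) (O : Set X), IsOpen N ∧ IsOpen O ∧
        1 ∈ N ∧ a ∈ O ∧ N ×ˢ O ⊆ (fun p : G × X => p.1 • p.2) ⁻¹' U' :=
      isOpen_prod_iff.1 (hU'.preimage continuous_smul) 1 a (by simpa using haU')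
    have hl : LegalMove (v⁻¹ • a) (pullMove v (O, V')) :=
      LegalMove.pull (by rw [smul_inv_smul]; exact ⟨⟨hO, haO⟩, hV', h1V'⟩)
    obtain ⟨g, hg, hgO, hTg⟩ := hT _ _ _ hTab _ hl
    have hgO' : v • g • b ∈ O := hgO
    have hTg' := hTinv v _ _ _ hTg
    rw [smul_inv_smul] at hTg'
    have hgm : g • b ∈ m.1 := by
      obtain ⟨k, p, rfl, hp⟩ := hg
      exact (hp k le_rfl).2
    -- Appending `v` to the simulated reply cancels the old error: the whole simulated position is
    -- translated by `v`, which puts its other point at `a`.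
    have hvg : IsLocalProduct U V b (v * g) :=
      (hg.mono hmU hmV).mul_left hvV (by rw [mul_smul]; exact hvU _ hgm)
    obtain ⟨g', ⟨hg'N, hg'V⟩, ⟨hg'U, hg'C⟩, γ, hγ, hγe⟩ := hf.exists_isLocalProduct ⟨hbU, hb⟩ hvg
      (N := {k | k * (v * g)⁻¹ ∈ N} ∩ {k | k * (v * g)⁻¹ ∈ V'})
      ((hN.preimage (by fun_prop)).inter (hV'.preimage (by fun_prop)))
      ⟨by simpa using h1N, by simpa using h1V'⟩
    have hg'b : g' • b = (g' * (v * g)⁻¹) • v • g • b := by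
      rw [← mul_smul, ← mul_smul]
      congr 1
      group
    have hg'U' : g' • b ∈ U' := by
      rw [hg'b]
      exact hNO (mk_mem_prod hg'N hgO')
    -- The new error `g' * (v * g)⁻¹` compares the perturbed reply `g'` with `v * g`.
    refine ⟨γ, hγ, ?_, g' • b, a, g' * (v * g)⁻¹, (O, V'), U', V', hg'C, ha, hγe.symm, rfl, ?_,
      haU', fun z hz => ?_, subset_rfl, hg'V, fun z hz => hNO (mk_mem_prod hg'N hz), hf'⟩
    · rw [← hγe]
      exact hf'.map_mem _ ⟨hg'U', hg'C⟩
    · rw [hg'b, inv_smul_smul]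
      exact hTg'
    · simpa using hNO (mk_mem_prod h1N hz)
  -- At the start there is no error and the pending move is trivial, so local control reduces to `f`
  -- preserving orbits.
  refine hS.hjorthIso ⟨x, y, 1, (univ, univ), univ, univ, hx, hy, rfl, rfl, by simpa using hTxy,
    trivial, subset_rfl, subset_rfl, trivial, fun _ _ => trivial, isOpen_univ, isOpen_univ,
    fun _ _ => trivial, fun z hz => ?_⟩
  filter_upwards [hC z hz.2] with g hg _
  obtain ⟨w, hw⟩ : ∃ w : H, w • f z = f (g • z) := hE _ _ ⟨g, rfl⟩
  exact ⟨hg, w, trivial, hw.symm⟩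

end Transfer

theorem mainTheorem6 {G H X Y : Type*}
    [Group G] [TopologicalSpace G] [IsTopologicalGroup G] [PolishSpace G]
    [Group H] [TopologicalSpace H] [IsTopologicalGroup H] [PolishSpace H]
    [TopologicalSpace X] [PolishSpace X] [MulAction G X] [ContinuousSMul G X]
    [TopologicalSpace Y] [PolishSpace Y] [MulAction H Y] [ContinuousSMul H Y]
    (f : X → Y) (hf : BaireMeasurableMap f) (hE : IsOrbitHom G H f) :
    ∃ X₀ : Set X, (∀ g : G, ∀ x ∈ X₀, g • x ∈ X₀) ∧ Dense X₀ ∧ IsGδ X₀ ∧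
      (hjorthGraphOn G X₀).IsHom (hjorthGraph H Y) (fun q => hE.orbitMap q.1) := by
  obtain ⟨C, hC, hCd, hfC, hloc⟩ := exists_locally_translating hf hE
  set X₀ := genericSaturation G C with hX₀
  refine ⟨X₀, fun g x hx => smul_mem_genericSaturation g hx,
    dense_genericSaturation (residual_of_dense_Gδ hC hCd), hC.genericSaturation, ?_⟩
  -- The transfer is applied to `C ∩ X₀` rather than `C`, because generic translates of its points
  -- must stay in the set.
  have hgen : ∀ x ∈ C ∩ X₀, ∀ᶠ g in residual G, g • x ∈ C ∩ X₀ := by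
    rintro x ⟨-, hx⟩
    have hx' : ∀ᶠ g in residual G, g • x ∈ C := hx
    filter_upwards [hx'] with g hg
    exact ⟨hg, smul_mem_genericSaturation g hx⟩
  have hloc' : ∀ x ∈ C ∩ X₀, ∀ m' : Set Y × Set H, LegalMove (f x) m' →
      ∃ m : Set X × Set G, LegalMove x m ∧
        IsGenericallyLocal f (C ∩ X₀) m.1 m.2 m'.1 m'.2 := by
    rintro x ⟨hx, -⟩ m' ⟨⟨hU', hxU'⟩, hW, h1W⟩
    obtain ⟨U, V, hU, hxU, hV, h1V, hUV⟩ := hloc x hx m'.2 hW h1W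
    obtain ⟨O, hO, hxO, hOC⟩ := mem_nhdsWithin.1 ((hfC x hx).preimage_mem_nhdsWithin
      (hU'.mem_nhds hxU'))
    refine ⟨(U ∩ O, V), ⟨⟨hU.inter hO, hxU, hxO⟩, hV, h1V⟩, hU.inter hO, hV,
      fun z hz => hOC ⟨hz.1.2, hz.2.1⟩, fun z hz => ?_⟩
    filter_upwards [hUV z ⟨hz.1.1, hz.2.1⟩, hgen z hz.2] with g hg hgC hgV
    exact ⟨hgC, hg hgV⟩
  have hmeet : ∀ x ∈ X₀, ∃ g : G, g • x ∈ C ∩ X₀ := by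
    intro x hx
    obtain ⟨g, hg⟩ := (dense_of_mem_residual
      (show {g : G | g • x ∈ C} ∈ residual G from hx)).nonempty
    exact ⟨g, hg, smul_mem_genericSaturation g hx⟩
  rintro ⟨_, x, hx, rfl⟩ ⟨_, y, hy, rfl⟩ hxy
  change HjorthIso G x y at hxy
  change HjorthIso H (f x) (f y)
  obtain ⟨g, hg⟩ := hmeet x hx
  obtain ⟨k, hk⟩ := hmeet y hy
  -- Both points may be moved within their orbits into `C ∩ X₀`, and the images moved back, since
  -- Hjorth isomorphism depends only on orbits.
  have key := HjorthIso.map_of_isGenericallyLocal hE hgen hloc' hg hk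
    ((hxy.smul_left g).smul_right k)
  obtain ⟨a, ha⟩ : ∃ a : H, a • f (g • x) = f x := hE _ _ ⟨g⁻¹, inv_smul_smul g x⟩
  obtain ⟨b, hb⟩ : ∃ b : H, b • f (k • y) = f y := hE _ _ ⟨k⁻¹, inv_smul_smul k y⟩
  rw [← ha, ← hb]
  exact (key.smul_left a).smul_right b
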